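/- A lattice in $\mathbb{R}^n$ is a discrete subgroup $L\subset\mathbb{R}^n$ that spans $\mathbb{R}^n$ over $\mathbb{R}$. Write $|L|=\min\{\|x\| : x\in L\setminus\{0\}\}$ for its minimal norm (with $\|\cdot\|$ the Euclidean norm), $S(L)=\{x\in L : \|x\|=|L|\}$ for its set of minimal vectors, $\det L$ for the volume of a fundamental parallelotope, and $$\delta(L)=\frac{\omega_n|L|^n}{2^n\det L}$$ for its packing density, where $\omega_n$ is the volume of the unit ball in $\mathbb{R}^n$. The space of lattices in $\mathbb{R}^n$ is identified with $\mathrm{GL}_n(\mathbb{R})/\mathrm{GL}_n(\mathbb{Z})$ (a lattice corresponds to the class of its basis matrices) and carries the quotient topology. A lattice $L$ is - extreme if it is a local maximum of $\delta$ on the space of lattices; - perfect if the matrices $xx^{\top}$, $x\in S(L)$, span the space of real symmetric $n\times n$ matrices; - well-rounded if $\operatorname{span}_{\mathbb{R}}S(L)=\operatorname{span}_{\mathbb{R}}L$; - weakly nearly orthogonal if it has an ordered $\mathbb{Z}$-basis $b_1,\dots,b_n$ such that, for every $1\le i\le n-1$, the angle between $b_{i+1}$ and the subspace $\operatorname{span}_{\mathbb{R}}\{b_1,\dots,b_i\}$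 is at least $\pi/3$. Two lattices $L_1,L_2$ are similar if $L_2=\alpha U L_1$ for some real $\alpha>0$ and some orthogonal $U$. Let $\mathcal{W}_n$ be the set of similarity classes of lattices in $\mathbb{R}^n$ that are well-rounded and weakly nearly orthogonal (both properties are invariant under similarity). **Corollary.** For every $n\ge 3$, the set $\mathcal{W}_n$ does not contain (the class of) any perfect lattice. Moreover, for every $n\ge 3$, $\mathcal{W}_n$ does not contain (the class of) any extreme lattice. -/

import Mathlib

open scoped Topology

noncomputable section

namespace NearlyOrthogonal

/-- A lattice (of full rank) in `ℝⁿ` with its Euclidean norm: a discrete additive subgroup that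
spans `ℝⁿ` over `ℝ`. -/
structure RLattice (n : ℕ) where
  carrier : Submodule ℤ (EuclideanSpace ℝ (Fin n))
  discrete : DiscreteTopology carrier
  isZLattice : IsZLattice ℝ carrier

/-- The `j`-th column of an invertible real matrix, as a vector of Euclidean space. -/
def column {n : ℕ} (g : Matrix.GeneralLinearGroup (Fin n) ℝ) (j : Fin n) :
    EuclideanSpace ℝ (Fin n) :=
  WithLp.toLp 2 (fun i => (g : Matrix (Fin n) (Fin n) ℝ) i j)

theorem exists_basis_eq_column {n : ℕ} (g : Matrix.GeneralLinearGroup (Fin n) ℝ) :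
    ∃ b : Module.Basis (Fin n) ℝ (EuclideanSpace ℝ (Fin n)), ⇑b = column g := by
  have h1 : LinearIndependent ℝ (g : Matrix (Fin n) (Fin n) ℝ).col :=
    Matrix.linearIndependent_cols_of_isUnit g.isUnit
  have h2 : LinearIndependent ℝ (column g) :=
    h1.map' (WithLp.linearEquiv 2 ℝ (Fin n → ℝ)).symm.toLinearMap (LinearEquiv.ker _)
  exact ⟨basisOfLinearIndependentOfCardEqFinrank' (column g) h2 (by simp),
    coe_basisOfLinearIndependentOfCardEqFinrank' _ _ _⟩

theorem discreteTopology_span_column {n : ℕ} (g : Matrix.GeneralLinearGroup (Fin n) ℝ) :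
    DiscreteTopology (Submodule.span ℤ (Set.range (column g))) := by
  obtain ⟨b, hb⟩ := exists_basis_eq_column g
  rw [← hb]
  infer_instance

/-- The lattice whose basis matrix is `g`, that is, the `ℤ`-span of the columns of `g`. -/
def latticeOfMatrix {n : ℕ} (g : Matrix.GeneralLinearGroup (Fin n) ℝ) : RLattice n where
  carrier := Submodule.span ℤ (Set.range (column g))
  discrete := discreteTopology_span_column g
  isZLattice := @IsZLattice.mk _ _ _ _ _ _ (discreteTopology_span_column g) (by
    obtain ⟨b, hb⟩ := exists_basis_eq_column g
    rw [← hb]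
    exact ZSpan.span_top b)

/-- Every lattice has a basis matrix. -/
theorem latticeOfMatrix_surjective (n : ℕ) : Function.Surjective (latticeOfMatrix (n := n)) := by
  rintro ⟨L, hd, hz⟩
  have := hd
  have := hz
  have hf : Module.Free ℤ L := ZLattice.module_free ℝ L
  have hfin : Module.Finite ℤ L := ZLattice.module_finite ℝ L
  have hr : Module.finrank ℤ L = n := by rw [ZLattice.rank ℝ L]; simp
  let b : Module.Basis (Fin n) ℤ L := (Module.finBasis ℤ L).reindex (finCongr hr)
  let B := b.ofZLatticeBasis ℝ L
  let M : Matrix (Fin n) (Fin n) ℝ := fun i j => B j i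
  have hM : IsUnit M := by
    rw [← Matrix.linearIndependent_cols_iff_isUnit]
    exact B.linearIndependent.map' (WithLp.linearEquiv 2 ℝ (Fin n → ℝ)).toLinearMap
      (LinearEquiv.ker _)
  refine ⟨hM.unit, ?_⟩
  have hc : column hM.unit = B := by
    funext j; ext i; simp only [column]; rw [IsUnit.unit_spec]
  have hL : Submodule.span ℤ (Set.range (column hM.unit)) = L := by
    rw [hc]; exact b.ofZLatticeBasis_span ℝ L
  unfold latticeOfMatrix
  simp only [RLattice.mk.injEq]
  exact hL

/-- The topology of the space of lattices, identified with `GLₙ(ℝ) / GLₙ(ℤ)`: every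
lattice is the column lattice of a matrix in `GLₙ(ℝ)`, and two matrices have the
same column lattice exactly when they differ by right multiplication by an element of `GLₙ(ℤ)`, so
the quotient topology is the one coinduced by `latticeOfMatrix`. -/
instance instTopologicalSpaceRLattice (n : ℕ) : TopologicalSpace (RLattice n) :=
  TopologicalSpace.coinduced latticeOfMatrix inferInstance

namespace RLattice

variable {n : ℕ}

/-- The minimal norm `|L|`, the smallest norm of a nonzero vector of `L`. -/
def minNorm (L : RLattice n) : ℝ :=
  sInf {r : ℝ | ∃ x ∈ L.carrier, x ≠ 0 ∧ ‖x‖ = r}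

/-- The set `S(L)` of minimal vectors. -/
def minVectors (L : RLattice n) : Set (EuclideanSpace ℝ (Fin n)) :=
  {x | x ∈ L.carrier ∧ ‖x‖ = L.minNorm}

/-- The density `δ(L) = ωₙ |L|ⁿ / (2ⁿ det L)` of the sphere packing associated with `L`, where `ωₙ`
is the volume of the unit ball and `det L` is the volume of a fundamental parallelotope of `L`. -/
def density (L : RLattice n) : ℝ :=
  MeasureTheory.volume.real (Metric.ball (0 : EuclideanSpace ℝ (Fin n)) 1) * L.minNorm ^ n /
    (2 ^ n * ZLattice.covolume L.carrier)

/-- `L` is extreme: a local maximum of the packing density on the space of lattices. -/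
def IsExtreme (L : RLattice n) : Prop :=
  IsLocalMax density L

/-- `L` is perfect: the matrices `x xᵀ`, for `x` a minimal vector of `L`, span the space of real
symmetric matrices. -/
def IsPerfect (L : RLattice n) : Prop :=
  (Submodule.span ℝ {A : Matrix (Fin n) (Fin n) ℝ | ∃ x ∈ L.minVectors,
      A = Matrix.vecMulVec (fun i => x i) (fun i => x i)} : Set (Matrix (Fin n) (Fin n) ℝ)) =
    {A | A.IsSymm}

/-- `L` is well-rounded. -/
def IsWellRounded (L : RLattice n) : Prop :=
  Submodule.span ℝ L.minVectors =
    Submodule.span ℝ (L.carrier : Set (EuclideanSpace ℝ (Fin n)))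

end RLattice

/-- The angle in `[0, π/2]` between a nonzero vector `x` and a subspace `V`, i.e. the angle between
`x` and its orthogonal projection to `V` (it is `π/2` when that projection vanishes). -/
def angleToSubspace {n : ℕ} (x : EuclideanSpace ℝ (Fin n))
    (V : Submodule ℝ (EuclideanSpace ℝ (Fin n))) : ℝ :=
  InnerProductGeometry.angle x (V.starProjection x)

/-- An ordered basis `b₁, …, bₙ` of the lattice `L` is weakly `θ`-orthogonal if each vector after the
first one makes an angle at least `θ` with the real span of the vectors that precede it. -/
def IsWeaklyOrthogonalBasis {n : ℕ} (θ : ℝ) {L : RLattice n}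
    (b : Module.Basis (Fin n) ℤ L.carrier) : Prop :=
  ∀ i : Fin n, 0 < (i : ℕ) →
    θ ≤ angleToSubspace (b i : EuclideanSpace ℝ (Fin n))
      (Submodule.span ℝ
        ((fun j : Fin n => (b j : EuclideanSpace ℝ (Fin n))) '' {j : Fin n | j < i}))

/-- `L` has a weakly `θ`-orthogonal basis. -/
def RLattice.IsWeaklyOrthogonal {n : ℕ} (θ : ℝ) (L : RLattice n) : Prop :=
  ∃ b : Module.Basis (Fin n) ℤ L.carrier, IsWeaklyOrthogonalBasis θ b

/-- Similarity of lattices: `L₂ = α U L₁` for some real `α > 0` and some linear isometry `U`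
of `ℝⁿ`. -/
def Similar {n : ℕ} (L₁ L₂ : RLattice n) : Prop :=
  ∃ (α : ℝ) (U : EuclideanSpace ℝ (Fin n) ≃ₗᵢ[ℝ] EuclideanSpace ℝ (Fin n)), 0 < α ∧
    (L₂.carrier : Set (EuclideanSpace ℝ (Fin n))) =
      (fun x => α • U x) '' (L₁.carrier : Set (EuclideanSpace ℝ (Fin n)))

theorem similar_equivalence (n : ℕ) : Equivalence (Similar (n := n)) where
  refl L := ⟨1, LinearIsometryEquiv.refl ℝ _, one_pos, by simp⟩
  symm := by
    rintro L₁ L₂ ⟨α, U, hα, h⟩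
    refine ⟨α⁻¹, U.symm, inv_pos.mpr hα, ?_⟩
    rw [h, Set.image_image]
    simp [smul_smul, inv_mul_cancel₀ hα.ne']
  trans := by
    rintro L₁ L₂ L₃ ⟨α, U, hα, h⟩ ⟨β, V, hβ, h'⟩
    refine ⟨β * α, U.trans V, mul_pos hβ hα, ?_⟩
    rw [h', h, Set.image_image]
    simp [smul_smul]

/-- Similarity as a setoid. -/
def similaritySetoid (n : ℕ) : Setoid (RLattice n) := ⟨Similar, similar_equivalence n⟩

/-- The set of similarity classes of lattices in `ℝⁿ`. -/
def SimilarityClass (n : ℕ) : Type := Quotient (similaritySetoid n)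

/-- The similarity class of a lattice. -/
def RLattice.simClass {n : ℕ} (L : RLattice n) : SimilarityClass n :=
  Quotient.mk (similaritySetoid n) L

/-- `WRₙ`: the similarity classes of well-rounded lattices. -/
def WR (n : ℕ) : Set (SimilarityClass n) :=
  {c | ∃ L : RLattice n, L.simClass = c ∧ L.IsWellRounded}

/-- `WOₙ(θ)`: the similarity classes of weakly `θ`-orthogonal lattices. -/
def WO (n : ℕ) (θ : ℝ) : Set (SimilarityClass n) :=
  {c | ∃ L : RLattice n, L.simClass = c ∧ L.IsWeaklyOrthogonal θ}

/-- `Wₙ = WRₙ ∩ WOₙ(π/3)`: the similarity classes of well-rounded weakly nearly orthogonal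
lattices. -/
def W (n : ℕ) : Set (SimilarityClass n) :=
  WR n ∩ WO n (Real.pi / 3)

end NearlyOrthogonal

end

namespace NearlyOrthogonal


/-! ### The minimal norm and the gap above it. -/

namespace RLattice

variable {n : ℕ}

/-! Let `p k` be the projection of `b k` to the span of the earlier basis vectors; the angle
condition says `‖p k‖ ≤ ‖b k‖ / 2`. If `x` is minimal with last nonzero coordinate at `k`, expanding
`‖x‖²` leaves no slack: up to sign `x` is `b k` or `b k - 2 p k` (`eq_or_eq_of_minimal`). Since `p 0
= 0`, the minimal vectors yield at most `2n - 1` matrices `x xᵀ`, fewer than `n(n+1)/2` once `n ≥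
3`, so the lattice is not perfect.

Extreme lattices are perfect by Voronoi's argument (`RLattice.IsExtreme.isPerfect`). Otherwise some
symmetric `A ≠ 0` with trace at most `0` is orthogonal to every `x xᵀ`. Deforming by `1 + tA` for
small `t > 0` shortens no minimal vector, keeps the others longer than the minimum, and strictly
lowers the covolume, so the density increases. -/

theorem minNorm_le (L : RLattice n) {x : EuclideanSpace ℝ (Fin n)} (hx : x ∈ L.carrier)
    (h0 : x ≠ 0) : L.minNorm ≤ ‖x‖ :=
  csInf_le ⟨0, by rintro _ ⟨y, -, -, rfl⟩; exact norm_nonneg y⟩ ⟨x, hx, h0, rfl⟩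

theorem exists_mem_ne_zero (L : RLattice n) (hn : n ≠ 0) : ∃ x ∈ L.carrier, x ≠ 0 := by
  have := L.discrete
  have h := L.isZLattice.span_top
  by_contra! hL
  have h' : (L.carrier : Set (EuclideanSpace ℝ (Fin n))) ⊆ {0} := fun x hx => hL x hx
  have h2 := Submodule.span_mono (R := ℝ) h'
  rw [h, Submodule.span_singleton_eq_bot.mpr rfl, top_le_iff] at h2
  have h3 := congrArg (fun V : Submodule ℝ (EuclideanSpace ℝ (Fin n)) => Module.finrank ℝ V) h2
  simp at h3
  exact hn h3.symm

theorem le_minNorm (L : RLattice n) (hn : n ≠ 0) {c : ℝ}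
    (h : ∀ x ∈ L.carrier, x ≠ 0 → c ≤ ‖x‖) : c ≤ L.minNorm := by
  obtain ⟨x, hx, h0⟩ := L.exists_mem_ne_zero hn
  refine le_csInf ⟨‖x‖, x, hx, h0, rfl⟩ ?_
  rintro _ ⟨y, hy, hy0, rfl⟩
  exact h y hy hy0

/-- The norms of a lattice exceeding the minimal norm are bounded away from it. -/
theorem exists_gap (L : RLattice n) :
    ∃ c, L.minNorm < c ∧ ∀ x ∈ L.carrier, L.minNorm < ‖x‖ → c ≤ ‖x‖ := by
  have := L.discrete
  -- A discrete subgroup is closed, so it meets a ball in finitely many points; the gap is then a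
  -- minimum over finitely many norms.
  have hfin : (Metric.closedBall (0 : EuclideanSpace ℝ (Fin n)) (L.minNorm + 1) ∩
      (L.carrier : Set (EuclideanSpace ℝ (Fin n)))).Finite := by
    refine Metric.finite_isBounded_inter_isClosed DiscreteTopology.isDiscrete
      Metric.isBounded_closedBall ?_
    change IsClosed (L.carrier.toAddSubgroup : Set (EuclideanSpace ℝ (Fin n)))
    exact AddSubgroup.isClosed_of_discrete
  have hfin' := (hfin.image norm).subset (Set.inter_subset_left (t := Set.Ioi L.minNorm))
  obtain ⟨c, hc, hmin⟩ : ∃ c, L.minNorm < c ∧ ∀ r ∈ norm ''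
      (Metric.closedBall (0 : EuclideanSpace ℝ (Fin n)) (L.minNorm + 1) ∩
      (L.carrier : Set (EuclideanSpace ℝ (Fin n)))) ∩ Set.Ioi L.minNorm, c ≤ r := by
    rcases Set.eq_empty_or_nonempty (norm ''
      (Metric.closedBall (0 : EuclideanSpace ℝ (Fin n)) (L.minNorm + 1) ∩
      (L.carrier : Set (EuclideanSpace ℝ (Fin n)))) ∩ Set.Ioi L.minNorm) with he | hne
    · exact ⟨L.minNorm + 1, by linarith, by simp [he]⟩
    · obtain ⟨r, hr, hr'⟩ := Set.exists_min_image _ id hfin' hne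
      exact ⟨r, hr.2, hr'⟩
  refine ⟨min c (L.minNorm + 1), lt_min hc (by linarith), fun x hx hlt => ?_⟩
  by_cases h : ‖x‖ ≤ L.minNorm + 1
  · exact (min_le_left _ _).trans (hmin _ ⟨⟨x, ⟨by simpa using h, hx⟩, rfl⟩, hlt⟩)
  · exact (min_le_right _ _).trans (not_le.mp h).le

/-- Some nonzero vector is shorter than the gap bound `c`, so its norm, which is positive, does not
exceed the minimal norm. -/
theorem minNorm_pos (L : RLattice n) (hn : n ≠ 0) : 0 < L.minNorm := by
  obtain ⟨c, hc, hgap⟩ := L.exists_gap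
  obtain ⟨x, hx, h0⟩ := L.exists_mem_ne_zero hn
  have hne : {r : ℝ | ∃ x ∈ L.carrier, x ≠ 0 ∧ ‖x‖ = r}.Nonempty := ⟨‖x‖, x, hx, h0, rfl⟩
  obtain ⟨_, ⟨y, hy, hy0, rfl⟩, hlt⟩ := exists_lt_of_csInf_lt hne hc
  have : ¬ L.minNorm < ‖y‖ := fun h => (hgap y hy h).not_gt hlt
  exact (norm_pos_iff.mpr hy0).trans_le (not_lt.mp this)

end RLattice

variable {n : ℕ}

/-! ### Minimal vectors of weakly `π/3`-orthogonal lattices. -/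

/-- With `p` the projection, `⟨x, p⟩ = ‖p‖²`, so the cosine of the angle is `‖p‖ / ‖x‖` when `p ≠
0`, and it is at most `1/2`. -/
theorem norm_starProjection_le_of_angle {x : EuclideanSpace ℝ (Fin n)}
    {V : Submodule ℝ (EuclideanSpace ℝ (Fin n))} (h : Real.pi / 3 ≤ angleToSubspace x V) :
    ‖V.starProjection x‖ ≤ ‖x‖ / 2 := by
  have hcos : Real.cos (angleToSubspace x V) ≤ 1 / 2 := by
    rw [← Real.cos_pi_div_three]
    exact Real.cos_le_cos_of_nonneg_of_le_pi (by positivity)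
      (InnerProductGeometry.angle_le_pi _ _) h
  have h1 := InnerProductGeometry.cos_angle_mul_norm_mul_norm x (V.starProjection x)
  have h2 : inner ℝ x (V.starProjection x) = ‖V.starProjection x‖ ^ 2 := by
    have := Submodule.starProjection_inner_eq_zero (K := V) x _ (V.starProjection_apply_mem x)
    rw [inner_sub_left, real_inner_self_eq_norm_sq] at this
    linarith
  rw [h2] at h1
  unfold angleToSubspace at hcos
  rcases (norm_nonneg (V.starProjection x)).eq_or_lt with h0 | h0
  · rw [← h0]; positivity
  · have h3 := mul_le_mul_of_nonneg_right hcos (mul_nonneg (norm_nonneg x) h0.le)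
    rw [h1] at h3
    refine le_of_mul_le_mul_right ?_ h0
    nlinarith

/-- Each vector of a weakly `π/3`-orthogonal basis projects to the span of the preceding ones with
at most half its norm. -/
theorem IsWeaklyOrthogonalBasis.norm_starProjection_le {L : RLattice n}
    {b : Module.Basis (Fin n) ℤ L.carrier} (hb : IsWeaklyOrthogonalBasis (Real.pi / 3) b)
    (i : Fin n) :
    ‖(Submodule.span ℝ ((fun j : Fin n => (b j : EuclideanSpace ℝ (Fin n))) ''
      {j | j < i})).starProjection (b i : EuclideanSpace ℝ (Fin n))‖ ≤
      ‖(b i : EuclideanSpace ℝ (Fin n))‖ / 2 := by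
  rcases Nat.eq_zero_or_pos (i : ℕ) with h0 | hpos
  -- The first vector carries no angle condition, but it projects to the zero subspace.
  · have : {j : Fin n | j < i} = ∅ := by
      ext j; simp only [Set.mem_ofPred_eq, Set.mem_empty_iff_false, iff_false, Fin.lt_def]; omega
    rw [this, Set.image_empty, Submodule.span_empty, Submodule.starProjection_bot,
      zero_apply, norm_zero]
    positivity
  · exact norm_starProjection_le_of_angle (hb i hpos)

/-- The numerical core of the analysis of minimal vectors. -/
theorem eq_of_sq_add_sq_sub_mul_le {m A Y : ℝ} (hm : 0 < m) (hA : m ≤ A) (hY : m ≤ Y)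
    (h : A ^ 2 + Y ^ 2 - A * Y ≤ m ^ 2) : A = m ∧ Y = m := by
  -- The left side of `h` is `(A - Y)² + AY`, which is at least `m²`, with equality only at `A = Y =
  -- m`.
  constructor <;> nlinarith [mul_nonneg (sub_nonneg.mpr hA) (sub_nonneg.mpr hY), sq_nonneg (A - Y)]

theorem exists_last_index (c : Fin n → ℤ) (hc : c ≠ 0) :
    ∃ k, c k ≠ 0 ∧ ∀ j, k < j → c j = 0 := by
  obtain ⟨i, hi⟩ := Function.ne_iff.mp hc
  have hne : (Finset.univ.filter fun i => c i ≠ 0).Nonempty := ⟨i, by simpa using hi⟩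
  refine ⟨_, (Finset.mem_filter.mp (Finset.max'_mem _ hne)).2, fun j hj => ?_⟩
  by_contra h
  exact (Finset.le_max' _ j (by simpa using h)).not_gt hj

/-- A minimal vector `x` of a lattice of the form `a b + y`, with `a ≠ 0` an integer and `y` a lattice
vector in a subspace `V` to which `b` projects with at most half its norm, is either `± b` or
`± (b - 2 p)`, with `p` the projection of `b` to `V`. -/
theorem eq_or_eq_of_minimal {E : Type*} [NormedAddCommGroup E] [InnerProductSpace ℝ E]
    {V : Submodule ℝ E} [V.HasOrthogonalProjection] {b y : E} {a : ℤ} {m : ℝ} (hm : 0 < m)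
    (hbm : m ≤ ‖b‖) (hbV : ‖V.starProjection b‖ ≤ ‖b‖ / 2) (ha : a ≠ 0) (hy : y ∈ V)
    (hym : y ≠ 0 → m ≤ ‖y‖) (hx : ‖a • b + y‖ = m) :
    ∃ ε : ℝ, ε ^ 2 = 1 ∧
      (a • b + y = ε • b ∨ a • b + y = ε • (b - (2 : ℝ) • V.starProjection b)) := by
  have ha1 : (1 : ℝ) ≤ |(a : ℝ)| := by exact_mod_cast Int.one_le_abs ha
  have haa : |(a : ℝ)| * ‖b‖ = m → |(a : ℝ)| = 1 ∧ ‖b‖ = m := by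
    intro h
    have : ‖b‖ = m := by nlinarith
    refine ⟨?_, this⟩
    rw [this] at h
    exact mul_right_cancel₀ hm.ne' (by linarith)
  rw [← Int.cast_smul_eq_zsmul ℝ] at hx ⊢
  by_cases h0 : y = 0
  · subst h0
    rw [add_zero, norm_smul, Real.norm_eq_abs] at hx
    exact ⟨a, by rw [← sq_abs, (haa hx).1, one_pow], Or.inl (add_zero _)⟩
  · have hpy : inner ℝ b y = inner ℝ (V.starProjection b) y := by
      have := Submodule.starProjection_inner_eq_zero (K := V) b _ hy
      rw [inner_sub_left] at this
      linarith
    have hle : |inner ℝ b y| ≤ ‖b‖ * ‖y‖ / 2 := by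
      rw [hpy]
      refine (abs_real_inner_le_norm _ _).trans ?_
      nlinarith [mul_le_mul_of_nonneg_right hbV (norm_nonneg y)]
    have hsq : m ^ 2 = (|(a : ℝ)| * ‖b‖) ^ 2 + 2 * ((a : ℝ) * inner ℝ b y) + ‖y‖ ^ 2 := by
      rw [← hx, norm_add_sq_real, norm_smul, Real.norm_eq_abs, real_inner_smul_left]
    have habs : -(|(a : ℝ)| * (‖b‖ * ‖y‖ / 2)) ≤ (a : ℝ) * inner ℝ b y := by
      refine le_trans (neg_le_neg ?_) (neg_abs_le _)
      rw [abs_mul]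
      exact mul_le_mul_of_nonneg_left hle (abs_nonneg _)
    -- The cross term is at least `-|a| ‖b‖ ‖y‖`, so `m² ≥ A² + Y² - AY` with `A = |a| ‖b‖` and `Y =
    -- ‖y‖`.
    obtain ⟨hA, hY⟩ := eq_of_sq_add_sq_sub_mul_le (A := |(a : ℝ)| * ‖b‖) (Y := ‖y‖) hm
      (by nlinarith) (hym h0) (by nlinarith)
    obtain ⟨ha', hb'⟩ := haa hA
    have ha2 : (a : ℝ) ^ 2 = 1 := by rw [← sq_abs, ha', one_pow]
    refine ⟨a, ha2, Or.inr ?_⟩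
    have hin : (a : ℝ) * inner ℝ (V.starProjection b) y = -(m ^ 2 / 2) := by
      rw [← hpy]
      rw [hA, hY] at hsq
      linarith
    -- With `p` the projection of `b`, the square is `4‖p‖² - 2m² + m²`, and `‖p‖ ≤ m/2`. Hence `y =
    -- -2a p`.
    have hz : ‖((2 : ℝ) * a) • V.starProjection b + y‖ ^ 2 ≤ 0 := by
      rw [norm_add_sq_real, norm_smul, real_inner_smul_left, mul_pow, Real.norm_eq_abs, sq_abs,
        mul_pow, ha2, hY, mul_assoc 2 (a : ℝ), hin]
      rw [hb'] at hbV
      nlinarith [norm_nonneg (V.starProjection b)]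
    have hz0 : ((2 : ℝ) * a) • V.starProjection b + y = 0 := by
      rw [← norm_eq_zero, ← sq_eq_zero_iff]
      exact le_antisymm hz (sq_nonneg _)
    rw [eq_neg_of_add_eq_zero_right hz0]
    module

/-- A minimal vector of a lattice with a weakly `π/3`-orthogonal basis is, up to sign, a basis vector
or its reflection in the orthogonal complement of the span of the preceding ones. -/
theorem RLattice.exists_eq_of_mem_minVectors {L : RLattice n} (hn : n ≠ 0)
    {b : Module.Basis (Fin n) ℤ L.carrier} (hb : IsWeaklyOrthogonalBasis (Real.pi / 3) b)
    {x : EuclideanSpace ℝ (Fin n)} (hx : x ∈ L.minVectors) :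
    ∃ (k : Fin n) (ε : ℝ), ε ^ 2 = 1 ∧
      (x = ε • (b k : EuclideanSpace ℝ (Fin n)) ∨
        x = ε • ((b k : EuclideanSpace ℝ (Fin n)) - (2 : ℝ) •
          (Submodule.span ℝ ((fun j : Fin n => (b j : EuclideanSpace ℝ (Fin n))) ''
            {j | j < k})).starProjection (b k : EuclideanSpace ℝ (Fin n)))) := by
  obtain ⟨hxL, hxm⟩ := hx
  have hm := L.minNorm_pos hn
  have hx0 : x ≠ 0 := by rintro rfl; rw [norm_zero] at hxm; exact hm.ne hxm
  let c := b.repr ⟨x, hxL⟩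
  have hc : (c : Fin n → ℤ) ≠ 0 := by
    intro h
    have h1 : c = 0 := DFunLike.coe_injective h
    have := (b.repr.map_eq_zero_iff).mp h1
    exact hx0 (congrArg Subtype.val this)
  -- Choosing the last nonzero coordinate puts the rest of `x` in the span of the vectors preceding
  -- `b k`.
  obtain ⟨k, hk, hlast⟩ := exists_last_index c hc
  have hsum : x = c k • (b k : EuclideanSpace ℝ (Fin n)) +
      ∑ j ∈ Finset.univ.filter (· < k), c j • (b j : EuclideanSpace ℝ (Fin n)) := by
    have h1 := congrArg Subtype.val (b.sum_repr ⟨x, hxL⟩)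
    rw [AddSubmonoidClass.coe_finsetSum] at h1
    simp only [SetLike.val_smul] at h1
    rw [← h1, ← Finset.add_sum_erase _ _ (Finset.mem_univ k)]
    congr 1
    symm
    refine Finset.sum_subset (fun j hj => ?_) (fun j hj hj' => ?_)
    · simp only [Finset.mem_filter, Finset.mem_univ, true_and] at hj
      simp [hj.ne]
    · simp only [Finset.mem_filter, Finset.mem_univ, true_and, not_lt] at hj'
      have : c j = 0 := hlast j (lt_of_le_of_ne hj' (Finset.ne_of_mem_erase hj).symm)
      change c j • _ = _
      rw [this, zero_smul]
  set y := ∑ j ∈ Finset.univ.filter (· < k), c j • (b j : EuclideanSpace ℝ (Fin n))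
  have hyL : y ∈ L.carrier := Submodule.sum_mem _ fun j _ => L.carrier.smul_mem _ (b j).2
  have hbk : (b k : EuclideanSpace ℝ (Fin n)) ≠ 0 := fun h => b.ne_zero k (Subtype.ext h)
  refine ⟨k, ?_⟩
  rw [hsum]
  refine eq_or_eq_of_minimal hm (L.minNorm_le (b k).2 hbk) (hb.norm_starProjection_le k) hk ?_
    (L.minNorm_le hyL) (by rw [← hsum, hxm])
  refine Submodule.sum_mem _ fun j hj => ?_
  rw [← Int.cast_smul_eq_zsmul ℝ]
  exact Submodule.smul_mem _ _ (Submodule.subset_span ⟨j, (Finset.mem_filter.mp hj).2, rfl⟩)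

/-! ### Counting: too few minimal vectors for perfection. -/

/-- The linear map from functions on unordered pairs to symmetric matrices. -/
def symMatrix (n : ℕ) : (Sym2 (Fin n) → ℝ) →ₗ[ℝ] Matrix (Fin n) (Fin n) ℝ where
  toFun f := Matrix.of fun i j => f s(i, j)
  map_add' _ _ := rfl
  map_smul' _ _ := rfl

theorem symMatrix_injective (n : ℕ) : Function.Injective (symMatrix n) := by
  intro f g h
  funext z
  induction z using Sym2.ind with
  | _ i j => exact congrFun (congrFun h i) j

theorem isSymm_symMatrix (f : Sym2 (Fin n) → ℝ) : (symMatrix n f).IsSymm := by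
  ext i j
  exact congrArg f Sym2.eq_swap

/-- A lattice in dimension at least three with a weakly `π/3`-orthogonal basis has too few minimal
vectors to be perfect. -/
theorem RLattice.IsWeaklyOrthogonal.not_isPerfect {L : RLattice n} (hn : 3 ≤ n)
    (hL : L.IsWeaklyOrthogonal (Real.pi / 3)) : ¬ L.IsPerfect := by
  intro hp
  obtain ⟨b, hb⟩ := hL
  have hn0 : n ≠ 0 := by omega
  let V : Fin n → Submodule ℝ (EuclideanSpace ℝ (Fin n)) := fun k =>
    Submodule.span ℝ ((fun j : Fin n => (b j : EuclideanSpace ℝ (Fin n))) '' {j | j < k})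
  let q : EuclideanSpace ℝ (Fin n) → Matrix (Fin n) (Fin n) ℝ := fun x =>
    Matrix.vecMulVec (fun i => x i) (fun i => x i)
  let r : Fin n → EuclideanSpace ℝ (Fin n) := fun k =>
    (b k : EuclideanSpace ℝ (Fin n)) - (2 : ℝ) • (V k).starProjection (b k)
  have hq : ∀ (ε : ℝ) (x : EuclideanSpace ℝ (Fin n)), ε ^ 2 = 1 → q (ε • x) = q x := by
    intro ε x hε
    ext i j
    simp only [q, Matrix.vecMulVec_apply, PiLp.smul_apply, smul_eq_mul]
    linear_combination x i * x j * hε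
  let i₀ : Fin n := ⟨0, by omega⟩
  -- This coincidence saves one matrix, which is needed when `n = 3`: there `2n = n(n+1)/2`.
  have hr0 : r i₀ = b i₀ := by
    have : {j : Fin n | j < i₀} = ∅ := by
      ext j; simp [i₀, Fin.lt_def]
    have hV : V i₀ = ⊥ := by simp only [V]; rw [this, Set.image_empty, Submodule.span_empty]
    have h0 := (V i₀).starProjection_apply_mem (b i₀ : EuclideanSpace ℝ (Fin n))
    rw [hV, Submodule.mem_bot] at h0
    simp only [r, hV]
    rw [h0, smul_zero, sub_zero]
  classical
  let F : Finset (Matrix (Fin n) (Fin n) ℝ) :=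
    (Finset.univ.image fun k => q (b k)) ∪ ((Finset.univ.erase i₀).image fun k => q (r k))
  have hF : F.card ≤ 2 * n - 1 := by
    refine (Finset.card_union_le _ _).trans ?_
    have h1 := Finset.card_image_le (s := (Finset.univ : Finset (Fin n)))
      (f := fun k => q (b k))
    have h2 := Finset.card_image_le (s := (Finset.univ : Finset (Fin n)).erase i₀)
      (f := fun k => q (r k))
    rw [Finset.card_erase_of_mem (Finset.mem_univ _)] at h2
    rw [Finset.card_univ, Fintype.card_fin] at h1 h2
    omega
  have hsub : {A : Matrix (Fin n) (Fin n) ℝ | ∃ x ∈ L.minVectors,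
      A = Matrix.vecMulVec (fun i => x i) (fun i => x i)} ⊆ F := by
    rintro _ ⟨x, hx, rfl⟩
    change q x ∈ F
    obtain ⟨k, ε, hε, h | h⟩ := L.exists_eq_of_mem_minVectors hn0 hb hx
    · rw [h, hq _ _ hε]
      exact Finset.mem_union_left _ (Finset.mem_image_of_mem _ (Finset.mem_univ k))
    · change x = ε • r k at h
      rw [h, hq _ _ hε]
      by_cases hk : k = i₀
      · rw [hk, hr0]
        exact Finset.mem_union_left _
          (Finset.mem_image_of_mem (fun k => q (b k)) (Finset.mem_univ i₀))
      · exact Finset.mem_union_right _ (Finset.mem_image_of_mem (fun k => q (r k))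
          (Finset.mem_erase.mpr ⟨hk, Finset.mem_univ k⟩))
  -- The range of `symMatrix` has dimension the number of unordered pairs, `n(n+1)/2`.
  have hle : LinearMap.range (symMatrix n) ≤ Submodule.span ℝ (F : Set _) := by
    rintro _ ⟨f, rfl⟩
    exact Submodule.span_mono hsub (hp.ge (isSymm_symMatrix f))
  have h1 := (Submodule.finrank_mono hle).trans (finrank_span_finset_le_card F)
  rw [LinearMap.finrank_range_of_inj (symMatrix_injective n), Module.finrank_fintype_fun_eq_card,
    Sym2.card, Fintype.card_fin] at h1
  have h2 := h1.trans hF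
  rw [Nat.choose_two_right, Nat.add_sub_cancel, Nat.div_le_iff_le_mul_add_pred two_pos] at h2
  have h4 : 3 * n ≤ n * n := Nat.mul_le_mul_right n hn
  have : (n + 1) * n = n * n + n := by ring
  omega

/-! ### Extreme lattices are perfect. -/

/-- For a lattice that is not perfect there is a nonzero quadratic form of nonpositive trace that
vanishes on all minimal vectors. -/
theorem RLattice.exists_isSymm_of_not_isPerfect {L : RLattice n} (hL : ¬ L.IsPerfect) :
    ∃ A : Matrix (Fin n) (Fin n) ℝ, A.IsSymm ∧ A ≠ 0 ∧ A.trace ≤ 0 ∧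
      ∀ x ∈ L.minVectors, ∑ i, ∑ j, x i * x j * A i j = 0 := by
  suffices h : ∃ A : Matrix (Fin n) (Fin n) ℝ, A.IsSymm ∧ A ≠ 0 ∧
      ∀ x ∈ L.minVectors, ∑ i, ∑ j, x i * x j * A i j = 0 by
    obtain ⟨A, h1, h2, h3⟩ := h
    rcases le_total A.trace 0 with ht | ht
    · exact ⟨A, h1, h2, ht, h3⟩
    · refine ⟨-A, h1.neg, neg_ne_zero.mpr h2, by simpa using ht, fun x hx => ?_⟩
      simp [h3 x hx]
  set S : Set (Matrix (Fin n) (Fin n) ℝ) := {A | ∃ x ∈ L.minVectors,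
      A = Matrix.vecMulVec (fun i => x i) (fun i => x i)} with hS
  have hsymm : (Submodule.span ℝ S : Set (Matrix (Fin n) (Fin n) ℝ)) ⊆ {A | A.IsSymm} := by
    intro A hA
    induction hA using Submodule.span_induction with
    | mem A hA =>
      obtain ⟨x, -, rfl⟩ := hA
      ext i j
      simp [Matrix.vecMulVec_apply, mul_comm]
    | zero => exact Matrix.isSymm_zero
    | add A B _ _ hA hB => exact Matrix.IsSymm.add hA hB
    | smul c A _ hA => exact Matrix.IsSymm.smul hA c
  obtain ⟨M, hM, hMS⟩ := Set.not_subset.mp fun h => hL (hsymm.antisymm h)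
  -- A functional `f` killing every `x xᵀ` but not the symmetric matrix `M` is symmetrized into `A`,
  -- whose pairing with a symmetric `X` is `2 f X`.
  obtain ⟨f, hfM, hf⟩ := Submodule.exists_le_ker_of_notMem hMS
  have hfe : ∀ X : Matrix (Fin n) (Fin n) ℝ,
      f X = ∑ i, ∑ j, X i j * f (Matrix.single i j 1) := by
    intro X
    conv_lhs => rw [Matrix.matrix_eq_sum_single X]
    simp only [map_sum]
    refine Finset.sum_congr rfl fun i _ => Finset.sum_congr rfl fun j _ => ?_
    rw [← smul_eq_mul (X i j), ← map_smul, Matrix.smul_single, smul_eq_mul, mul_one]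
  have key : ∀ X : Matrix (Fin n) (Fin n) ℝ, X.IsSymm →
      ∑ i, ∑ j, X i j * (f (Matrix.single i j 1) + f (Matrix.single j i 1)) = 2 * f X := by
    intro X hX
    simp only [mul_add, Finset.sum_add_distrib]
    rw [two_mul, hfe X]
    congr 1
    rw [Finset.sum_comm]
    refine Finset.sum_congr rfl fun i _ => Finset.sum_congr rfl fun j _ => ?_
    rw [hX.apply]
  refine ⟨Matrix.of fun i j => f (Matrix.single i j 1) + f (Matrix.single j i 1), ?_, ?_, ?_⟩
  · ext i j
    simp [add_comm]
  · intro h0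
    have h1 := key M hM
    have h2 : ∀ i j, f (Matrix.single i j 1) + f (Matrix.single j i 1) = 0 := fun i j =>
      congrFun (congrFun h0 i) j
    simp only [h2, mul_zero, Finset.sum_const_zero] at h1
    exact hfM (by linarith)
  · intro x hx
    have hxS : Matrix.vecMulVec (fun i => x i) (fun i => x i) ∈ Submodule.span ℝ S :=
      Submodule.subset_span ⟨x, hx, rfl⟩
    have h1 := key _ (hsymm hxS)
    rw [LinearMap.mem_ker.mp (hf hxS), mul_zero] at h1
    exact h1

/-- Near the identity, in a direction of nonpositive trace, the determinant is less than one. -/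
theorem det_one_add_smul_mem_Ioo {A : Matrix (Fin n) (Fin n) ℝ} (hA : A.IsHermitian) (h0 : A ≠ 0)
    (htr : A.trace ≤ 0) {t : ℝ} (ht : 0 < t) (hpos : ∀ i, 0 < 1 + t * hA.eigenvalues i) :
    (1 + t • A).det ∈ Set.Ioo (0 : ℝ) 1 := by
  have hdet : (1 + t • A).det = ∏ i, (1 + t * hA.eigenvalues i) := by
    have h1 : 1 + t • A = Unitary.conjStarAlgAut ℝ _ hA.eigenvectorUnitary
        (Matrix.diagonal fun i => 1 + t * hA.eigenvalues i) := by
      have h2 : (Matrix.diagonal fun i => 1 + t * hA.eigenvalues i) =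
          1 + t • Matrix.diagonal (RCLike.ofReal ∘ hA.eigenvalues : Fin n → ℝ) := by
        ext i j
        by_cases hij : i = j
        · subst hij; simp
        · simp [hij]
      rw [h2, map_add, map_one, map_smul, ← hA.spectral_theorem]
    rw [h1, Unitary.conjStarAlgAut_apply, Matrix.det_mul_right_comm, ← Matrix.det_diagonal]
    simp
  rw [hdet]
  refine ⟨Finset.prod_pos fun i _ => hpos i, ?_⟩
  obtain ⟨i, hi⟩ := Function.ne_iff.mp (mt hA.eigenvalues_eq_zero_iff.mp h0)
  -- `1 + s ≤ exp s` is strict for `s ≠ 0`, and `A ≠ 0` has a nonzero eigenvalue.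
  calc ∏ i, (1 + t * hA.eigenvalues i) < ∏ i, Real.exp (t * hA.eigenvalues i) := by
        refine Finset.prod_lt_prod (fun i _ => hpos i) (fun i _ => ?_) ⟨i, Finset.mem_univ i, ?_⟩
        · rw [add_comm]; exact Real.add_one_le_exp _
        · rw [add_comm]; exact Real.add_one_lt_exp (mul_ne_zero ht.ne' hi)
    _ = Real.exp (t * A.trace) := by
        rw [← Real.exp_sum, ← Finset.mul_sum, hA.trace_eq_sum_eigenvalues]
        rfl
    _ ≤ 1 := Real.exp_le_one_iff.mpr (mul_nonpos_of_nonneg_of_nonpos ht.le htr)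

/-- Only ratios of covolumes matter later, so the constant factor is left unevaluated. -/
theorem covolume_latticeOfMatrix (g : Matrix.GeneralLinearGroup (Fin n) ℝ) :
    ZLattice.covolume (latticeOfMatrix g).carrier =
      |(g : Matrix (Fin n) (Fin n) ℝ).det| * MeasureTheory.volume.real
        (ZSpan.fundamentalDomain (EuclideanSpace.basisFun (Fin n) ℝ).toBasis) := by
  have := (latticeOfMatrix g).discrete
  have := (latticeOfMatrix g).isZLattice
  obtain ⟨b, hb⟩ := exists_basis_eq_column g
  have hc : (latticeOfMatrix g).carrier = Submodule.span ℤ (Set.range b) := by rw [hb]; rfl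
  let b' : Module.Basis (Fin n) ℤ (latticeOfMatrix g).carrier :=
    (b.restrictScalars ℤ).map (LinearEquiv.ofEq _ _ hc.symm)
  rw [ZLattice.covolume_eq_det_mul_measureReal (latticeOfMatrix g).carrier
    (μ := MeasureTheory.volume) b' (EuclideanSpace.basisFun (Fin n) ℝ).toBasis]
  congr 2
  rw [Module.Basis.det_apply]
  congr 1
  ext i j
  have : (b' j : EuclideanSpace ℝ (Fin n)) = column g j := by
    rw [← hb]
    simp [b']
  simp [Module.Basis.toMatrix_apply, this, column]

theorem mem_latticeOfMatrix_of_eq_mul {u g : Matrix.GeneralLinearGroup (Fin n) ℝ}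
    {B : Matrix (Fin n) (Fin n) ℝ} (h : (u : Matrix (Fin n) (Fin n) ℝ) = B * g)
    {x : EuclideanSpace ℝ (Fin n)} (hx : x ∈ (latticeOfMatrix u).carrier) :
    ∃ y ∈ (latticeOfMatrix g).carrier, x = Matrix.toEuclideanCLM (𝕜 := ℝ) B y := by
  have hcol : ∀ j, column u j = Matrix.toEuclideanCLM (𝕜 := ℝ) B (column g j) := by
    intro j
    ext i
    simp [column, h, Matrix.mul_apply, Matrix.mulVec, dotProduct]
  have hle : (latticeOfMatrix u).carrier ≤ (latticeOfMatrix g).carrier.map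
      ((Matrix.toEuclideanCLM (𝕜 := ℝ) B).toLinearMap.restrictScalars ℤ) := by
    refine Submodule.span_le.mpr ?_
    rintro _ ⟨j, rfl⟩
    exact ⟨column g j, Submodule.subset_span ⟨j, rfl⟩, (hcol j).symm⟩
  obtain ⟨y, hy, rfl⟩ := hle hx
  exact ⟨y, hy, rfl⟩

section

attribute [local instance] Matrix.linftyOpNormedRing Matrix.linftyOpNormedAlgebra

/-- The norm serves only to make matrices a complete normed ring, whose units embed openly;
deformations can then be written as curves of matrices. -/
theorem isOpenMap_generalLinearGroup_val (n : ℕ) :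
    IsOpenMap (fun u : Matrix.GeneralLinearGroup (Fin n) ℝ => (u : Matrix (Fin n) (Fin n) ℝ)) :=
  Units.isOpenMap_val

end

/-- Every matrix near a basis matrix of an extreme lattice is a basis matrix of a lattice that is not
denser. -/
theorem RLattice.IsExtreme.eventually {g : Matrix.GeneralLinearGroup (Fin n) ℝ}
    (hg : (latticeOfMatrix g).IsExtreme) :
    ∀ᶠ M in 𝓝 (g : Matrix (Fin n) (Fin n) ℝ),
      ∃ u : Matrix.GeneralLinearGroup (Fin n) ℝ, (u : Matrix (Fin n) (Fin n) ℝ) = M ∧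
        (latticeOfMatrix u).density ≤ (latticeOfMatrix g).density := by
  have hcont : Continuous (latticeOfMatrix (n := n)) := continuous_coinduced_rng
  have h1 : {u | (latticeOfMatrix u).density ≤ (latticeOfMatrix g).density} ∈ 𝓝 g :=
    hcont.continuousAt.eventually hg
  filter_upwards [(isOpenMap_generalLinearGroup_val n).image_mem_nhds h1] with M hM
  obtain ⟨u, hu, rfl⟩ := hM
  exact ⟨u, rfl, hu⟩

theorem inner_toEuclideanCLM (A : Matrix (Fin n) (Fin n) ℝ) (x : EuclideanSpace ℝ (Fin n)) :
    inner ℝ x (Matrix.toEuclideanCLM (𝕜 := ℝ) A x) = ∑ i, ∑ j, x i * x j * A i j := by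
  simp only [PiLp.inner_apply, RCLike.inner_apply, conj_trivial, Matrix.ofLp_toEuclideanCLM,
    Matrix.mulVec, dotProduct, Finset.sum_mul]
  exact Finset.sum_congr rfl fun i _ => Finset.sum_congr rfl fun j _ => by ring

/-- Extreme lattices are perfect. -/
theorem RLattice.IsExtreme.isPerfect {L : RLattice n} (hn : n ≠ 0) (hL : L.IsExtreme) :
    L.IsPerfect := by
  by_contra hp
  obtain ⟨A, hA, hA0, htr, hmin⟩ := L.exists_isSymm_of_not_isPerfect hp
  obtain ⟨g, rfl⟩ := latticeOfMatrix_surjective n L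
  have hH : A.IsHermitian := hA
  obtain ⟨c, hc, hgap⟩ := (latticeOfMatrix g).exists_gap
  set m := (latticeOfMatrix g).minNorm with hm
  have hm0 : 0 < m := (latticeOfMatrix g).minNorm_pos hn
  set a := Matrix.toEuclideanCLM (𝕜 := ℝ) A with ha
  have hcurve : Filter.Tendsto
      (fun t : ℝ => (1 + t • A) * (g : Matrix (Fin n) (Fin n) ℝ)) (𝓝[>] 0) (𝓝 g.val) := by
    have : Continuous fun t : ℝ => (1 + t • A) * (g : Matrix (Fin n) (Fin n) ℝ) := by fun_prop
    have h := this.tendsto 0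
    rw [zero_smul, add_zero, one_mul] at h
    exact h.mono_left nhdsWithin_le_nhds
  have heig : ∀ᶠ t in 𝓝[>] (0 : ℝ), ∀ i, 0 < 1 + t * hH.eigenvalues i := by
    refine Filter.eventually_all.mpr fun i => nhdsWithin_le_nhds ?_
    have : Continuous fun t : ℝ => 1 + t * hH.eigenvalues i := by fun_prop
    exact this.continuousAt.eventually_const_lt (by simp)
  -- Nonminimal vectors have norm at least `c` and shrink by a factor no smaller than `1 - t‖a‖`, so
  -- they stay longer than `m`.
  have hnorm : ∀ᶠ t in 𝓝[>] (0 : ℝ), m < (1 - t * ‖a‖) * c := by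
    refine nhdsWithin_le_nhds ?_
    have : Continuous fun t : ℝ => (1 - t * ‖a‖) * c := by fun_prop
    exact this.continuousAt.eventually_const_lt (by simpa using hc)
  obtain ⟨t, ⟨u, hu, hd⟩, ht1, ht2, ht⟩ := ((hcurve.eventually hL.eventually).and
    (heig.and (hnorm.and self_mem_nhdsWithin))).exists
  have ht : 0 < t := ht
  obtain ⟨hdet0, hdet1⟩ := det_one_add_smul_mem_Ioo hH hA0 htr ht ht1
  have hmu : m ≤ (latticeOfMatrix u).minNorm := by
    refine (latticeOfMatrix u).le_minNorm hn fun x hx hx0 => ?_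
    obtain ⟨y, hy, rfl⟩ := mem_latticeOfMatrix_of_eq_mul hu hx
    have hy0 : y ≠ 0 := by rintro rfl; exact hx0 (map_zero _)
    have hform : Matrix.toEuclideanCLM (𝕜 := ℝ) (1 + t • A) y = y + t • a y := by
      rw [map_add, map_one, map_smul]
      rfl
    rw [hform]
    have hmy : m ≤ ‖y‖ := (latticeOfMatrix g).minNorm_le hy hy0
    -- For minimal `y`, `⟨y, a y⟩ = 0`, so `‖y + t a y‖² = ‖y‖² + ‖t a y‖²`.
    rcases hmy.eq_or_lt with h | h
    · have hin : inner ℝ y (a y) = 0 := by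
        rw [ha, inner_toEuclideanCLM]
        exact hmin y ⟨hy, h.symm⟩
      refine hmy.trans (le_of_sq_le_sq ?_ (norm_nonneg _))
      rw [norm_add_sq_real, real_inner_smul_right, hin]
      nlinarith [sq_nonneg ‖t • a y‖]
    · have hcy := hgap y hy h
      have h1 : ‖t • a y‖ ≤ t * ‖a‖ * ‖y‖ := by
        rw [norm_smul, Real.norm_of_nonneg ht.le, mul_assoc]
        exact mul_le_mul_of_nonneg_left (a.le_opNorm y) ht.le
      have h2 : ‖y‖ - ‖t • a y‖ ≤ ‖y + t • a y‖ := by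
        have := norm_sub_le (y + t • a y) (t • a y)
        rw [add_sub_cancel_right] at this
        linarith
      have h3 : 0 < 1 - t * ‖a‖ := by
        by_contra h
        nlinarith
      nlinarith [mul_le_mul_of_nonneg_left hcy h3.le]
  have hcov : ZLattice.covolume (latticeOfMatrix u).carrier <
      ZLattice.covolume (latticeOfMatrix g).carrier := by
    have := (latticeOfMatrix g).discrete
    have := (latticeOfMatrix g).isZLattice
    have hpos := ZLattice.covolume_pos (latticeOfMatrix g).carrier MeasureTheory.volume
    rw [covolume_latticeOfMatrix] at hpos
    rw [covolume_latticeOfMatrix, covolume_latticeOfMatrix, hu, Matrix.det_mul, abs_mul,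
      abs_of_pos hdet0, mul_assoc]
    exact mul_lt_of_lt_one_left hpos hdet1
  have := (latticeOfMatrix u).discrete
  have := (latticeOfMatrix u).isZLattice
  have hposu := ZLattice.covolume_pos (latticeOfMatrix u).carrier MeasureTheory.volume
  have hball : 0 < MeasureTheory.volume.real
      (Metric.ball (0 : EuclideanSpace ℝ (Fin n)) 1) :=
    ENNReal.toReal_pos (Metric.measure_ball_pos _ _ one_pos).ne' MeasureTheory.measure_ball_lt_top.ne
  refine hd.not_gt ?_
  unfold RLattice.density
  rw [← hm]
  refine (div_lt_div_of_pos_left (by positivity) (by positivity)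
    (mul_lt_mul_of_pos_left hcov (by positivity))).trans_le ?_
  gcongr

/-! ### Passage to similarity classes. -/

open scoped Pointwise in
/-- Similarity preserves weak orthogonality. -/
theorem RLattice.IsWeaklyOrthogonal.of_similar {θ : ℝ} {L₁ L₂ : RLattice n}
    (h : Similar L₁ L₂) (hL : L₁.IsWeaklyOrthogonal θ) : L₂.IsWeaklyOrthogonal θ := by
  obtain ⟨α, U, hα, hU⟩ := h
  obtain ⟨b, hb⟩ := hL
  let T : EuclideanSpace ℝ (Fin n) ≃ₗ[ℝ] EuclideanSpace ℝ (Fin n) :=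
    U.toLinearEquiv.trans (LinearEquiv.smulOfNeZero ℝ _ α hα.ne')
  let T' := T.restrictScalars ℤ
  have hc : L₁.carrier.map (T' : _ →ₗ[ℤ] _) = L₂.carrier :=
    SetLike.coe_injective hU.symm
  let b' : Module.Basis (Fin n) ℤ L₂.carrier :=
    b.map ((T'.submoduleMap L₁.carrier).trans (LinearEquiv.ofEq _ _ hc))
  have hb' : ∀ i, (b' i : EuclideanSpace ℝ (Fin n)) = α • U (b i) := fun i => by
    simp only [b', Module.Basis.map_apply, LinearEquiv.trans_apply, LinearEquiv.coe_ofEq_apply]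
    rfl
  refine ⟨b', fun i hi => ?_⟩
  -- Scaling by `α` does not change a span, so only the isometry `U` acts on subspaces, and
  -- projections commute with it.
  have hspan : Submodule.span ℝ ((fun j : Fin n => (b' j : EuclideanSpace ℝ (Fin n))) ''
      {j | j < i}) = (Submodule.span ℝ ((fun j : Fin n => (b j : EuclideanSpace ℝ (Fin n))) ''
      {j | j < i})).map (U.toLinearEquiv : _ →ₗ[ℝ] _) := by
    have hset : (fun j : Fin n => (b' j : EuclideanSpace ℝ (Fin n))) '' {j | j < i} =
        α • ((U.toLinearEquiv : EuclideanSpace ℝ (Fin n) →ₗ[ℝ] EuclideanSpace ℝ (Fin n)) ''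
          ((fun j : Fin n => (b j : EuclideanSpace ℝ (Fin n))) '' {j | j < i})) := by
      rw [← Set.image_smul, Set.image_image, Set.image_image]
      exact Set.image_congr fun j _ => hb' j
    rw [Submodule.map_span, hset, Submodule.span_smul_eq_of_isUnit _ _ hα.ne'.isUnit]
  have hbi := hb i hi
  unfold angleToSubspace at hbi ⊢
  simp only [hspan]
  rw [hb', map_smul, InnerProductGeometry.angle_smul_smul hα.ne',
    Submodule.starProjection_map_apply, LinearIsometryEquiv.symm_apply_apply]
  exact hbi.trans_eq (U.toLinearIsometry.angle_map _ _).symm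

theorem isWeaklyOrthogonal_of_simClass_mem_W {L : RLattice n} (hL : L.simClass ∈ W n) :
    L.IsWeaklyOrthogonal (Real.pi / 3) := by
  -- The class contains some weakly orthogonal `L'`, possibly different from `L`.
  obtain ⟨L', hL', hw⟩ := hL.2
  exact hw.of_similar (Quotient.exact hL')

end NearlyOrthogonal

theorem mainTheorem4 (n : ℕ) (hn : 3 ≤ n) :
    (∀ L : NearlyOrthogonal.RLattice n, L.simClass ∈ NearlyOrthogonal.W n → ¬ L.IsPerfect) ∧
    (∀ L : NearlyOrthogonal.RLattice n, L.simClass ∈ NearlyOrthogonal.W n → ¬ L.IsExtreme) := by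
  have h : ∀ L : NearlyOrthogonal.RLattice n, L.simClass ∈ NearlyOrthogonal.W n →
      ¬ L.IsPerfect := fun L hL =>
    (NearlyOrthogonal.isWeaklyOrthogonal_of_simClass_mem_W hL).not_isPerfect hn
  exact ⟨h, fun L hL hE => h L hL (hE.isPerfect (by omega))⟩
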